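/- Let $n\ge 0$ be an integer and let $a,b,c$ be free parameters (elements of any commutative ring). Let $\mathcal R$ be the set of Rogers–Ramanujan partitions, i.e. partitions into positive parts any two of which differ by at least $2$ (the empty partition included). For $\pi\in\mathcal R$, a chain of $\pi$ is a maximal block of parts with consecutive differences exactly $2$; every $\pi\in\mathcal R$ decomposes uniquely into its chains. For a chain $\chi$ with $\ell$ parts and least part $\lambda$ put $$ \omega(\chi)=\begin{cases} c^{\ell-1}(c+ab), & \lambda \text{ even},\\[2pt] a^{\ell}+(1+c)\sum_{k=1}^{\ell-1}a^kb^{\ell-k}+b^{\ell}, & \lambda=1,\\[2pt] (1+c)\Bigl\{a^{\ell}+(1+c)\sum_{k=1}^{\ell-1}a^kb^{\ell-k}+b^{\ell}\Bigr\}, & \lambda>1 \text{ odd}, \end{cases} $$ and let $\omega(\pi)=\prod_{\chi}\omega(\chi)$ be the product over the chains of $\pi$. Write $\sigma(\pi)$ for the sum and $\nu(\pi)$ for the number of parts of a partition $\pi$, and let $\mathcal V$ be the set of triples $\vec\pi=(\pi_1,\pi_2,\pi_3)$ of partitions (possibly empty) where $\pi_1$ and $\pi_2$ have distinct odd parts and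 $\pi_3$ has distinct even parts, with $\sigma(\vec\pi)=\sigma(\pi_1)+\sigma(\pi_2)+\sigma(\pi_3)$. Then $$ \sum_{\pi\in\mathcal R,\ \sigma(\pi)=n}\omega(\pi)=\sum_{\vec\pi\in\mathcal V,\ \sigma(\vec\pi)=n}a^{\nu(\pi_1)}b^{\nu(\pi_2)}c^{\nu(\pi_3)} . $$ -/

import Mathlib

namespace RogersRamanujan

/-- The partitions of `n` whose parts differ pairwise by at least `2`
(so in particular no part is repeated). -/
def rrPartitions (n : ℕ) : Finset n.Partition :=
  Finset.univ.filter fun p =>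
    p.parts.Nodup ∧ ∀ i ∈ p.parts, ∀ j ∈ p.parts, i < j → i + 2 ≤ j

/-- `lam, lam + 2, …, lam + 2 * (len - 1)` is a chain of `S`: a nonempty block of elements of `S`
with consecutive differences exactly `2` which cannot be extended at either end. -/
def IsMaxChain (S : Finset ℕ) (lam len : ℕ) : Prop :=
  1 ≤ len ∧ (∀ j < len, lam + 2 * j ∈ S) ∧ (∀ m ∈ S, m + 2 ≠ lam) ∧ lam + 2 * len ∉ S

instance (S : Finset ℕ) (lam len : ℕ) : Decidable (IsMaxChain S lam len) := by
  unfold IsMaxChain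
  infer_instance

/-- The chains of `S`; a chain is recorded as the pair (least part, length). -/
def chains (S : Finset ℕ) : Finset (ℕ × ℕ) :=
  (S ×ˢ Finset.Icc 1 S.card).filter fun x => IsMaxChain S x.1 x.2

/-- The range of the filter in `chains` loses nothing. -/
theorem mem_chains {S : Finset ℕ} {x : ℕ × ℕ} : x ∈ chains S ↔ IsMaxChain S x.1 x.2 := by
  simp only [chains, Finset.mem_filter, Finset.mem_product, Finset.mem_Icc, and_iff_right_iff_imp]
  rintro ⟨h1, h2, -, -⟩
  refine ⟨by simpa using h2 0 h1, h1, ?_⟩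
  have h := Finset.card_le_card_of_injOn (s := Finset.range x.2) (t := S)
    (fun j => x.1 + 2 * j) (fun j hj => h2 j (by simpa using hj))
    (fun i _ j _ hij => by simp only at hij; omega)
  simpa using h

variable {K : Type*} [CommRing K]

/-- `a ^ len + (1 + c) * ∑_{k = 1}^{len - 1} a ^ k * b ^ (len - k) + b ^ len`. -/
def oddBlockWeight (a b c : K) (len : ℕ) : K :=
  a ^ len + (1 + c) * ∑ k ∈ Finset.Ico 1 len, a ^ k * b ^ (len - k) + b ^ len

/-- The weight of a chain with least part `lam` and length `len ≥ 1`. -/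
def chainWeight (a b c : K) (lam len : ℕ) : K :=
  if Even lam then c ^ (len - 1) * (c + a * b)
  else if lam = 1 then oddBlockWeight a b c len
  else (1 + c) * oddBlockWeight a b c len

/-- The weight of a partition: the product of the weights of its chains. -/
def weight (a b c : K) {n : ℕ} (p : n.Partition) : K :=
  ∏ x ∈ chains p.parts.toFinset, chainWeight a b c x.1 x.2

/-- Partitions of `n` into distinct even parts. -/
def evenDistincts (n : ℕ) : Finset n.Partition :=
  Nat.Partition.restricted n Even ∩ Nat.Partition.distincts n

/-- The triples `(π₁, π₂, π₃)` of partitions with total sum `n`, where `π₁` and `π₂` have distinct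
odd parts and `π₃` has distinct even parts; the first component records the three sums. -/
def vectorPartitions (n : ℕ) :
    Finset (Σ s : ℕ × ℕ × ℕ, s.1.Partition × s.2.1.Partition × s.2.2.Partition) :=
  ((Finset.range (n + 1) ×ˢ Finset.range (n + 1) ×ˢ Finset.range (n + 1)).filter
      fun s => s.1 + s.2.1 + s.2.2 = n).sigma
    fun s => Nat.Partition.oddDistincts s.1 ×ˢ Nat.Partition.oddDistincts s.2.1 ×ˢ
      evenDistincts s.2.2

end RogersRamanujan

/-! Both sides are coefficients of q^n, so the weighted generating function of Rogers–Ramanujan sets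
has to equal ∏ (1 + a q^(2k+1)) (1 + b q^(2k+1)) (1 + c q^(2k+2)).

Bound the parts by 2n+1 and remove the top part. The weight of an odd chain sums words of a's below
b's, with a factor 1 + c at a change of letter and another at the start unless the least part is 1.
Hence a four-state recurrence, `transfer`, computes the generating function (`gapGF_eq_transfer`).

The recurrence satisfies functional equations. Replacing c by c q^2 splits off 1 + c q^2 up to
multiples of q^(2n+2) (`transfer_shift_c`). At c = 0, replacing a by a q^2 splits off 1 + a q up to
such multiples (`oddTotal_shift_a`). At a = c = 0 the product in b remains. If q^(2n+2) = 0 these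
errors vanish and finitely many replacements kill c and a (`oddTotal_eq_prod`). Taking q = X modulo
X^(2n+2) gives the coefficients (`coeff_gapGF`). -/

namespace RogersRamanujan

/-! ### Functional equations of the transfer recurrence -/

section Recurrence

variable {R : Type*} [CommRing R]

/-- The data from which the generating functions of Rogers–Ramanujan sets with bounded parts are
computed: `total` collects all sets with parts at most `2 * n`, `oddA` and `oddB` those whose
largest part is `2 * n + 1`, and `(c + a * b) * q ^ (2 * n + 2) * even` those whose largest part
is `2 * n + 2`. -/
structure TransferState (R : Type*) where
  total : R
  oddA : R
  oddB : R
  even : R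

/-- The sequence of transfer states. -/
def transfer (q a b c : R) : ℕ → TransferState R
  | 0 => ⟨1, a * q, b * q, 1⟩
  | n + 1 =>
    let v := transfer q a b c n
    ⟨v.total + v.oddA + v.oddB + (c + a * b) * q ^ (2 * n + 2) * v.even,
      a * q ^ (2 * n + 3) * ((1 + c) * v.total + v.oddA),
      b * q ^ (2 * n + 3) * ((1 + c) * (v.total + v.oddA) + v.oddB),
      v.total + v.oddA + v.oddB + c * q ^ (2 * n + 2) * v.even⟩

/-- The generating function of Rogers–Ramanujan sets with parts at most `2 * n + 1`. -/
def oddTotal (q a b c : R) (n : ℕ) : R :=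
  (transfer q a b c n).total + (transfer q a b c n).oddA + (transfer q a b c n).oddB

/-- Contiguity relations between the transfer states for `c * q ^ 2` and for `c`. -/
theorem transfer_shift_c (q a b c : R) (n : ℕ) :
    let v := transfer q a b c n
    let w := transfer q a b (c * q ^ 2) n
    w.oddA = q ^ (2 * n) * ((1 + q * a) * v.even - v.total) ∧
    w.oddB = q ^ (2 * n + 1) * (b * v.even + q * c * (v.total - v.even)) ∧
    (1 + c * q ^ 2) * (w.total + w.oddA + w.oddB) = v.total + v.oddA + v.oddB
      + q ^ (2 * n + 2) * (c + q * c * (a + b) - q ^ 2 * c ^ 2) * v.even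
      + q ^ (2 * n + 4) * c ^ 2 * v.total ∧
    (1 + c * q ^ 2) * ((c * q ^ 2 + a * b) * q ^ (2 * n + 2) * w.even) =
      q ^ (2 * n + 2) * ((a - q * c) * (b - q * c) * v.even + q * c * (a + b) * v.total
        + q * b * c * v.oddA - q * a * v.oddB - q * c * (a + b) * q ^ (2 * n + 2) * v.even
        + a * b * q ^ (2 * n + 2) * v.even
        + c * q ^ 2 * (v.total + v.oddA + v.oddB + c * q ^ (2 * n + 2) * v.even)
        - q ^ 2 * c ^ 2 * v.total) := by
  induction n with
  | zero => simp only [transfer]; refine ⟨?_, ?_, ?_, ?_⟩ <;> ring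
  | succ n ih =>
    simp only [transfer] at ih ⊢
    generalize transfer q a b c n = v at *
    generalize transfer q a b (c * q ^ 2) n = w at *
    obtain ⟨s, A, B, d⟩ := v
    obtain ⟨s', A', B', d'⟩ := w
    simp only at ih ⊢
    obtain ⟨hA, hB, hT, hC⟩ := ih
    -- `hT` controls only the sum s' + A' + B' multiplied by 1 + c q^2; subtracting multiples of
    -- `hA` and `hB` isolates the combinations that the recurrence feeds into `oddA` and `oddB`.
    have eA : a * q ^ (2 * n + 3) * ((1 + c * q ^ 2) * s' + A') = q ^ (2 * (n + 1)) *
        ((1 + q * a) * (s + A + B + c * q ^ (2 * n + 2) * d) -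
          (s + A + B + (c + a * b) * q ^ (2 * n + 2) * d)) := by
      linear_combination a * q ^ (2 * n + 3) * (hT - c * q ^ 2 * hA - (1 + c * q ^ 2) * hB)
    have eB : b * q ^ (2 * n + 3) * ((1 + c * q ^ 2) * (s' + A') + B') = q ^ (2 * (n + 1) + 1) *
        (b * (s + A + B + c * q ^ (2 * n + 2) * d) + q * c *
          ((s + A + B + (c + a * b) * q ^ (2 * n + 2) * d) -
          (s + A + B + c * q ^ (2 * n + 2) * d))) := by
      linear_combination b * q ^ (2 * n + 3) * (hT - c * q ^ 2 * hB)
    refine ⟨eA, eB, ?_, ?_⟩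
    · rw [eA, eB]
      linear_combination hT + hC
    · linear_combination (c * q ^ 2 + a * b) * q ^ (2 * n + 4) * hT + c * q ^ 2 * q ^ (2 * n + 4) * hC

/-- Contiguity relation between `a * q ^ 2` and `a` at `c = 0`. -/
theorem oddTotal_shift_a (q a b : R) (n : ℕ) :
    (1 + a * q) * oddTotal q (a * q ^ 2) b 0 n =
      oddTotal q a b 0 (n + 1) - b * q ^ (2 * n + 3) * oddTotal q a b 0 n := by
  -- At c = 0 the `even` entry is the previous `oddTotal`, so the system collapses to a three-term
  -- recurrence.
  have rec_u (a : R) (n : ℕ) : oddTotal q a b 0 (n + 2) =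
      (1 + (a + b) * q ^ (2 * n + 5)) * oddTotal q a b 0 (n + 1)
        + a * b * q ^ (2 * n + 4) * (1 - q ^ (2 * n + 4)) * oddTotal q a b 0 n := by
    simp only [oddTotal, transfer]
    ring
  induction n using Nat.twoStepInduction with
  | zero => simp only [oddTotal, transfer]; ring
  | one => simp only [oddTotal, transfer]; ring
  | more n ih0 ih1 =>
    rw [rec_u a (n + 1), rec_u (a * q ^ 2) n]
    have h : oddTotal q a b 0 (n + 1 + 1) = _ := rec_u a n
    linear_combination (1 + (a * q ^ 2 + b) * q ^ (2 * n + 5)) * ih1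
      + a * q ^ 2 * b * q ^ (2 * n + 4) * (1 - q ^ (2 * n + 4)) * ih0
      + b * q ^ (2 * n + 5) * h

/-- At a = c = 0 even parts have weight 0 and each odd part contributes b independently. -/
theorem oddTotal_zero_zero (q b : R) (n : ℕ) :
    oddTotal q 0 b 0 n = ∏ k ∈ Finset.range (n + 1), (1 + b * q ^ (2 * k + 1)) := by
  induction n with
  | zero => simp [oddTotal, transfer]
  | succ n ih =>
    rw [Finset.prod_range_succ, ← ih]
    simp only [oddTotal, transfer]
    have hA (n : ℕ) : (transfer q 0 b 0 n).oddA = 0 := by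
      cases n <;> simp [transfer]
    rw [hA]
    ring

theorem oddTotal_mul_c {q : R} {n : ℕ} (hq : q ^ (2 * n + 2) = 0) (a b c : R) :
    oddTotal q a b c n = (1 + c * q ^ 2) * oddTotal q a b (c * q ^ 2) n := by
  have h := (transfer_shift_c q a b c n).2.2.1
  simp only [pow_add q (2 * n) 4, pow_add q (2 * n) 2] at h hq
  simp only [oddTotal]
  linear_combination -h - (c + q * c * (a + b) - q ^ 2 * c ^ 2) * (transfer q a b c n).even * hq
    - q ^ 2 * c ^ 2 * (transfer q a b c n).total * hq

theorem oddTotal_mul_a {q : R} {n : ℕ} (hq : q ^ (2 * n + 2) = 0) (a b : R) :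
    oddTotal q a b 0 n = (1 + a * q) * oddTotal q (a * q ^ 2) b 0 n := by
  have h3 : q ^ (2 * n + 3) = 0 := by rw [pow_succ, hq, zero_mul]
  rw [oddTotal_shift_a]
  simp [oddTotal, transfer, hq, h3]

theorem oddTotal_eq_prod {q : R} {n : ℕ} (hq : q ^ (2 * n + 2) = 0) (a b c : R) :
    oddTotal q a b c n = (∏ k ∈ Finset.range (n + 1), (1 + a * q ^ (2 * k + 1))) *
      (∏ k ∈ Finset.range (n + 1), (1 + b * q ^ (2 * k + 1))) *
      ∏ k ∈ Finset.range (n + 1), (1 + c * q ^ (2 * k + 2)) := by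
  have hc (N : ℕ) : oddTotal q a b c n = (∏ k ∈ Finset.range N, (1 + c * q ^ (2 * k + 2))) *
      oddTotal q a b (c * q ^ (2 * N)) n := by
    induction N with
    | zero => simp
    | succ N ih =>
      rw [ih, oddTotal_mul_c hq, Finset.prod_range_succ]
      ring_nf
  have ha (N : ℕ) : oddTotal q a b 0 n = (∏ k ∈ Finset.range N, (1 + a * q ^ (2 * k + 1))) *
      oddTotal q (a * q ^ (2 * N)) b 0 n := by
    induction N with
    | zero => simp
    | succ N ih =>
      rw [ih, oddTotal_mul_a hq, Finset.prod_range_succ]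
      ring_nf
  -- After n + 1 replacements the parameter carries q^(2n+2), hence is 0.
  have hq' : q ^ (2 * (n + 1)) = 0 := hq
  rw [hc (n + 1), hq', mul_zero, ha (n + 1), hq', mul_zero, oddTotal_zero_zero]
  ring

end Recurrence

/-! ### Splitting off the last chain -/

section Chains

/-- The block `lam, lam + 2, …, lam + 2 * (len - 1)`. -/
def block (lam len : ℕ) : Finset ℕ :=
  (Finset.range len).image fun j => lam + 2 * j

theorem mem_block {lam len m : ℕ} : m ∈ block lam len ↔ ∃ j < len, lam + 2 * j = m := by
  simp [block]

theorem sum_block (lam len : ℕ) : ∑ m ∈ block lam len, m = ∑ j ∈ Finset.range len, (lam + 2 * j) :=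
  Finset.sum_image fun _ _ _ _ h => by omega

theorem disjoint_block {S : Finset ℕ} {lam : ℕ} (hS : ∀ m ∈ S, m + 3 ≤ lam) (len : ℕ) :
    Disjoint S (block lam len) := by
  rw [Finset.disjoint_left]
  intro m hm hb
  obtain ⟨j, -, rfl⟩ := mem_block.1 hb
  have := hS _ hm
  omega

/-- A gap of at least 3 below the block keeps it from joining any chain of S, so old chains survive
and the block is one new chain. -/
theorem chains_union_block {S : Finset ℕ} {lam len : ℕ} (hlen : 1 ≤ len)
    (hS : ∀ m ∈ S, m + 3 ≤ lam) :
    chains (S ∪ block lam len) = insert (lam, len) (chains S) := by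
  ext ⟨l, k⟩
  simp only [mem_chains, Finset.mem_insert, IsMaxChain, Finset.mem_union, mem_block, Prod.mk.injEq]
  constructor
  · rintro ⟨hk, hmem, hlow, hhigh⟩
    rcases hmem 0 (by omega) with h0 | ⟨j, hj, hj'⟩
    · right
      have hall : ∀ i < k, l + 2 * i ∈ S := by
        intro i
        induction i with
        | zero => exact fun _ => h0
        | succ i ih =>
          intro hi
          have := hS _ (ih (by omega))
          rcases hmem (i + 1) hi with h | ⟨j, hj, hj'⟩
          · exact h
          · omega
      exact ⟨hk, hall, fun m hm => hlow m (Or.inl hm), fun h => hhigh (Or.inl h)⟩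
    · left
      have hj0 : j = 0 := by
        by_contra hne
        exact hlow (lam + 2 * (j - 1)) (Or.inr ⟨j - 1, by omega, rfl⟩) (by omega)
      have hl : l = lam := by omega
      subst hl
      refine ⟨rfl, le_antisymm ?_ ?_⟩
      · by_contra hlt
        rcases hmem len (by omega) with h | ⟨i, hi, hi'⟩
        · have := hS _ h
          omega
        · omega
      · by_contra hlt
        exact hhigh (Or.inr ⟨k, by omega, rfl⟩)
  · rintro (⟨rfl, rfl⟩ | ⟨hk, hmem, hlow, hhigh⟩)
    · refine ⟨hlen, fun j hj => Or.inr ⟨j, hj, rfl⟩, ?_, ?_⟩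
      · rintro m (hm | ⟨j, hj, rfl⟩) h
        · have := hS _ hm
          omega
        · omega
      · rintro (hm | ⟨j, hj, h⟩)
        · have := hS _ hm
          omega
        · omega
    · have htop := hS _ (hmem (k - 1) (by omega))
      have hl := hS _ (hmem 0 (by omega))
      refine ⟨hk, fun j hj => Or.inl (hmem j hj), ?_, ?_⟩
      · rintro m (hm | ⟨j, hj, rfl⟩)
        · exact hlow m hm
        · omega
      · rintro (hm | ⟨j, hj, h⟩)
        · exact hhigh hm
        · omega

theorem notMem_chains_of_lt {S : Finset ℕ} {lam : ℕ} (hS : ∀ m ∈ S, m + 3 ≤ lam) (len : ℕ) :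
    (lam, len) ∉ chains S := by
  intro h
  obtain ⟨h1, h2, -⟩ := mem_chains.1 h
  have := hS _ (h2 0 h1)
  omega

/-- The sets of positive integers at most `N` whose elements differ pairwise by at least `2`. -/
def gapSets (N : ℕ) : Finset (Finset ℕ) :=
  (Finset.Icc 1 N).powerset.filter fun S => ∀ i ∈ S, ∀ j ∈ S, i < j → i + 2 ≤ j

theorem mem_gapSets {N : ℕ} {S : Finset ℕ} : S ∈ gapSets N ↔
    (∀ m ∈ S, 1 ≤ m ∧ m ≤ N) ∧ ∀ i ∈ S, ∀ j ∈ S, i < j → i + 2 ≤ j := by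
  simp [gapSets, Finset.subset_iff]

variable {R : Type*} [CommRing R]

/-- The product of the weights of the chains of `S`. -/
def setWeight (a b c : R) (S : Finset ℕ) : R :=
  ∏ x ∈ chains S, chainWeight a b c x.1 x.2

theorem setWeight_union_block (a b c : R) {S : Finset ℕ} {lam len : ℕ} (hlen : 1 ≤ len)
    (hS : ∀ m ∈ S, m + 3 ≤ lam) :
    setWeight a b c (S ∪ block lam len) = chainWeight a b c lam len * setWeight a b c S := by
  rw [setWeight, chains_union_block hlen hS, Finset.prod_insert (notMem_chains_of_lt hS len)]
  rfl

/-- The weighted generating function of `gapSets N`. -/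
def gapGF (q a b c : R) (N : ℕ) : R :=
  ∑ S ∈ gapSets N, setWeight a b c S * q ^ ∑ m ∈ S, m

theorem gapGF_zero (q a b c : R) : gapGF q a b c 0 = 1 := by
  have h : gapSets 0 = {∅} := by
    ext S
    simp only [mem_gapSets, Finset.mem_singleton]
    constructor
    · rintro ⟨h, -⟩
      exact Finset.eq_empty_of_forall_notMem fun m hm => by have := h m hm; omega
    · rintro rfl
      simp
  have hc : chains ∅ = ∅ := rfl
  simp [gapGF, h, setWeight, hc]

/-- The sum over the gap sets whose largest element is `N + 1`, sorted by the length `j + 1` of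
the last chain, with `F` as the weight of that chain. -/
def topSum (q a b c : R) (F : ℕ → ℕ → R) (N : ℕ) : R :=
  ∑ j ∈ Finset.range (N / 2 + 1), F (N + 1 - 2 * j) (j + 1) *
    (∏ i ∈ Finset.range (j + 1), q ^ (N + 1 - 2 * i)) * gapGF q a b c (N - 2 - 2 * j)

theorem gapGF_succ (q a b c : R) (N : ℕ) :
    gapGF q a b c (N + 1) = gapGF q a b c N + topSum q a b c (chainWeight a b c) N := by
  have hsplit : (gapSets (N + 1)).filter (fun S => N + 1 ∉ S) = gapSets N := by
    ext S
    simp only [Finset.mem_filter, mem_gapSets]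
    constructor
    · rintro ⟨⟨h1, h2⟩, h3⟩
      refine ⟨fun m hm => ?_, h2⟩
      have := h1 m hm
      have : m ≠ N + 1 := fun h => h3 (h ▸ hm)
      omega
    · rintro ⟨h1, h2⟩
      exact ⟨⟨fun m hm => by have := h1 m hm; omega, h2⟩,
        fun h => by have := h1 _ h; omega⟩
  rw [gapGF, ← Finset.sum_filter_add_sum_filter_not _ (fun S => N + 1 ∉ S), hsplit, ← gapGF]
  congr 1
  simp only [topSum, gapGF, Finset.mul_sum]
  rw [Finset.sum_sigma']
  symm
  -- If the chain starts at 1 or 2, the truncated bound N - 2 - 2j is 0 and S is empty.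
  have hlow {j : ℕ} {S : Finset ℕ} (hS : S ∈ gapSets (N - 2 - 2 * j)) :
      ∀ m ∈ S, m + 3 ≤ N + 1 - 2 * j := fun m hm => by
    have := (mem_gapSets.1 hS).1 m hm
    omega
  refine Finset.sum_bij (fun x _ => x.2 ∪ block (N + 1 - 2 * x.1) (x.1 + 1)) ?_ ?_ ?_ ?_
  · rintro ⟨j, S⟩ hx
    simp only [Finset.mem_sigma, Finset.mem_range] at hx
    obtain ⟨hj, hS⟩ := hx
    have hl := hlow hS
    simp only [Finset.mem_filter, mem_gapSets, Finset.mem_union, mem_block, not_not]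
    have hS' := mem_gapSets.1 hS
    refine ⟨⟨?_, ?_⟩, Or.inr ⟨j, by omega, by omega⟩⟩
    · rintro m (hm | ⟨i, hi, rfl⟩)
      · have := hS'.1 m hm
        omega
      · omega
    · rintro i (hi | ⟨i', hi', rfl⟩) k (hk | ⟨k', hk', rfl⟩) hik
      · exact hS'.2 i hi k hk hik
      · have := hl i hi
        omega
      · have := hl k hk
        omega
      · omega
  · have key : ∀ (j k : ℕ) (S T : Finset ℕ), j < N / 2 + 1 → k < N / 2 + 1 →
        S ∈ gapSets (N - 2 - 2 * j) →
        S ∪ block (N + 1 - 2 * j) (j + 1) = T ∪ block (N + 1 - 2 * k) (k + 1) → k ≤ j := by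
      intro j k S T hj hk hS h
      by_contra hlt
      -- The longer chain contains the number two below the least part of the shorter one, which the
      -- other union omits.
      have hmem : N + 1 - 2 * (j + 1) ∈ T ∪ block (N + 1 - 2 * k) (k + 1) :=
        Finset.mem_union_right _ (mem_block.2 ⟨k - (j + 1), by omega, by omega⟩)
      rw [← h, Finset.mem_union, mem_block] at hmem
      rcases hmem with hm | ⟨i, hi, hi'⟩
      · have := hlow hS _ hm
        omega
      · omega
    have sub : ∀ (j : ℕ) (S T : Finset ℕ), S ∈ gapSets (N - 2 - 2 * j) →
        S ∪ block (N + 1 - 2 * j) (j + 1) = T ∪ block (N + 1 - 2 * j) (j + 1) → S ⊆ T := by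
      intro j S T hS h m hm
      have hmem := Finset.mem_union_left (block (N + 1 - 2 * j) (j + 1)) hm
      rw [h, Finset.mem_union, mem_block] at hmem
      rcases hmem with hm' | ⟨i, hi, hi'⟩
      · exact hm'
      · have := hlow hS _ hm
        omega
    rintro ⟨j, S⟩ hx ⟨k, T⟩ hy h
    simp only [Finset.mem_sigma, Finset.mem_range] at hx hy h
    obtain rfl : j = k := le_antisymm (key k j T S hy.1 hx.1 hy.2 h.symm)
      (key j k S T hx.1 hy.1 hx.2 h)
    rw [(sub j S T hx.2 h).antisymm (sub j T S hy.2 h.symm)]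
  · intro S hS
    simp only [Finset.mem_filter, mem_gapSets, not_not] at hS
    obtain ⟨⟨h1, h2⟩, h3⟩ := hS
    have h0 : 0 ∉ S := fun h => by have := h1 0 h; omega
    have hex : ∃ j, N + 1 - 2 * (j + 1) ∉ S := ⟨N, by
      rw [show N + 1 - 2 * (N + 1) = 0 by omega]; exact h0⟩
    classical
    -- Descending from N + 1 in steps of 2, the first missing number determines the last chain, of
    -- length j + 1.
    obtain ⟨j, hj, hmin⟩ : ∃ j, N + 1 - 2 * (j + 1) ∉ S ∧ ∀ i < j, N + 1 - 2 * (i + 1) ∈ S :=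
      ⟨Nat.find hex, Nat.find_spec hex, fun i hi => not_not.1 (Nat.find_min hex hi)⟩
    have hin : ∀ i ≤ j, N + 1 - 2 * i ∈ S := by
      intro i hi
      rcases i with _ | i
      · exact h3
      · exact hmin i (by omega)
    have hjN := h1 _ (hin j le_rfl)
    refine ⟨⟨j, S.filter (· ≤ N - 2 - 2 * j)⟩, ?_, ?_⟩
    · simp only [Finset.mem_sigma, Finset.mem_range, mem_gapSets, Finset.mem_filter]
      exact ⟨by omega, fun m hm => ⟨(h1 m hm.1).1, hm.2⟩,
        fun i hi k hk => h2 i hi.1 k hk.1⟩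
    · ext m
      simp only [Finset.mem_union, Finset.mem_filter, mem_block]
      constructor
      · rintro (hm | ⟨i, hi, rfl⟩)
        · exact hm.1
        · have := hin (j - i) (by omega)
          rwa [show N + 1 - 2 * j + 2 * i = N + 1 - 2 * (j - i) by omega]
      · intro hm
        by_contra hcon
        push Not at hcon
        have hm1 := h1 m hm
        have hlt := hcon.1 hm
        -- At even distance from N + 1, m lies in the chain or is the missing number; at odd
        -- distance it is adjacent to a chain element or already at most N - 2 - 2j.
        obtain ⟨i, hi⟩ : ∃ i, N + 1 - m = 2 * i ∨ N + 1 - m = 2 * i + 1 :=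
          ⟨(N + 1 - m) / 2, by omega⟩
        rcases hi with hi | hi
        · by_cases hij : i ≤ j
          · exact hcon.2 (j - i) (by omega) (by omega)
          · apply hj
            rwa [show N + 1 - 2 * (j + 1) = m by omega]
        · by_cases hij : i ≤ j
          · have := h2 m hm _ (hin i hij) (by omega)
            omega
          · omega
  · rintro ⟨j, S⟩ hx
    simp only [Finset.mem_sigma, Finset.mem_range] at hx
    obtain ⟨hj, hS⟩ := hx
    have hl := hlow hS
    simp only
    rw [setWeight_union_block a b c (by omega) hl, Finset.sum_union (disjoint_block hl _), sum_block,
      pow_add, Finset.prod_pow_eq_pow_sum,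
      ← Finset.sum_range_reflect (fun i => N + 1 - 2 * i),
      Finset.sum_congr rfl (fun i hi => show N + 1 - 2 * j + 2 * i
        = N + 1 - 2 * (j + 1 - 1 - i) by have := Finset.mem_range.1 hi; omega)]
    ring

end Chains

/-! ### The generating function obeys the transfer recurrence -/

section GeneratingFunction

variable {R : Type*} [CommRing R]

/-- The factor `1 + c` of the odd chains with least part greater than `1`. -/
def startFactor (c : R) (lam : ℕ) : R :=
  if lam = 1 then 1 else 1 + c

/-- The monomial `a ^ len` together with the factor for the least part. -/
def oddWeightA (a c : R) (lam len : ℕ) : R :=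
  startFactor c lam * a ^ len

/-- The part of the weight of an odd chain whose terms contain `b`. -/
def oddWeightB (a b c : R) (lam len : ℕ) : R :=
  startFactor c lam * ((1 + c) * ∑ k ∈ Finset.Ico 1 len, a ^ k * b ^ (len - k) + b ^ len)

theorem oddWeightA_succ (a c : R) (lam len : ℕ) :
    oddWeightA a c lam (len + 1) = a * oddWeightA a c lam len := by
  simp only [oddWeightA]
  ring

/-- A new top letter b either follows an all-a word, costing 1 + c for the change, or extends a word
already ending in b. -/
theorem oddWeightB_succ (a b c : R) (lam : ℕ) {len : ℕ} (hlen : 1 ≤ len) :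
    oddWeightB a b c lam (len + 1) =
      (1 + c) * b * oddWeightA a c lam len + b * oddWeightB a b c lam len := by
  have h : ∑ k ∈ Finset.Ico 1 len, a ^ k * b ^ (len + 1 - k) =
      b * ∑ k ∈ Finset.Ico 1 len, a ^ k * b ^ (len - k) := by
    rw [Finset.mul_sum]
    refine Finset.sum_congr rfl fun k hk => ?_
    rw [Nat.succ_sub (Finset.mem_Ico.1 hk).2.le, pow_succ]
    ring
  simp only [oddWeightB, oddWeightA, Finset.sum_Ico_succ_top hlen, h, Nat.add_sub_cancel_left]
  ring

theorem chainWeight_odd (a b c : R) {lam : ℕ} (hlam : Odd lam) (len : ℕ) :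
    chainWeight a b c lam len = oddWeightA a c lam len + oddWeightB a b c lam len := by
  rw [chainWeight, if_neg (Nat.not_even_iff_odd.2 hlam)]
  simp only [oddWeightA, oddWeightB, startFactor, oddBlockWeight]
  split_ifs <;> ring

/-- Deleting the top part N + 3 leaves either an empty last chain or one with the same least part
and top N + 1. -/
theorem topSum_add_two (q a b c : R) (F : ℕ → ℕ → R) (N : ℕ) :
    topSum q a b c F (N + 2) = F (N + 3) 1 * q ^ (N + 3) * gapGF q a b c N
      + q ^ (N + 3) * topSum q a b c (fun lam len => F lam (len + 1)) N := by
  rw [topSum, show (N + 2) / 2 + 1 = N / 2 + 1 + 1 by omega, Finset.sum_range_succ', add_comm]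
  congr 1
  · simp
  · rw [topSum, Finset.mul_sum]
    refine Finset.sum_congr rfl fun j _ => ?_
    rw [Finset.prod_range_succ', show N + 2 + 1 - 2 * (j + 1) = N + 1 - 2 * j by omega,
      show N + 2 - 2 - 2 * (j + 1) = N - 2 - 2 * j by omega,
      Finset.prod_congr rfl (fun i _ => show q ^ (N + 2 + 1 - 2 * (i + 1)) = q ^ (N + 1 - 2 * i) by
        congr 1; omega)]
    simp only [mul_zero, Nat.sub_zero]
    ring

theorem topSum_add (q a b c : R) (F G : ℕ → ℕ → R) (N : ℕ) :
    topSum q a b c (fun lam len => F lam len + G lam len) N =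
      topSum q a b c F N + topSum q a b c G N := by
  simp only [topSum, add_mul, Finset.sum_add_distrib]

theorem topSum_const_mul (q a b c x : R) (F : ℕ → ℕ → R) (N : ℕ) :
    topSum q a b c (fun lam len => x * F lam len) N = x * topSum q a b c F N := by
  simp only [topSum, mul_assoc, Finset.mul_sum]

theorem topSum_congr (q a b c : R) {F G : ℕ → ℕ → R} {N : ℕ}
    (h : ∀ j ≤ N / 2, F (N + 1 - 2 * j) (j + 1) = G (N + 1 - 2 * j) (j + 1)) :
    topSum q a b c F N = topSum q a b c G N :=
  Finset.sum_congr rfl fun j hj => by rw [h j (by have := Finset.mem_range.1 hj; omega)]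

theorem gapGF_odd_succ (q a b c : R) (n : ℕ) :
    gapGF q a b c (2 * n + 1) = gapGF q a b c (2 * n)
      + topSum q a b c (oddWeightA a c) (2 * n) + topSum q a b c (oddWeightB a b c) (2 * n) := by
  rw [gapGF_succ, add_assoc, ← topSum_add]
  congr 1
  exact topSum_congr q a b c fun j hj =>
    chainWeight_odd a b c (by rw [Nat.odd_iff]; omega) _

theorem topSum_even_add_two (q a b c : R) (n : ℕ) :
    topSum q a b c (chainWeight a b c) (2 * n + 3) = (c + a * b) * q ^ (2 * n + 4) *
      gapGF q a b c (2 * n + 1)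
      + q ^ (2 * n + 4) * c * topSum q a b c (chainWeight a b c) (2 * n + 1) := by
  have h : topSum q a b c (fun lam len => chainWeight a b c lam (len + 1)) (2 * n + 1) =
      topSum q a b c (fun lam len => c * chainWeight a b c lam len) (2 * n + 1) := by
    refine topSum_congr q a b c fun j hj => ?_
    have he : Even (2 * n + 1 + 1 - 2 * j) := by rw [Nat.even_iff]; omega
    simp only [chainWeight, if_pos he, Nat.add_sub_cancel, pow_succ]
    ring
  have h1 : chainWeight a b c (2 * n + 4) 1 = c + a * b := by
    rw [chainWeight, if_pos ⟨n + 2, by ring⟩]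
    simp
  rw [topSum_add_two q a b c _ (2 * n + 1), h, topSum_const_mul, h1]
  ring

theorem gapGF_eq_transfer (q a b c : R) (n : ℕ) :
    gapGF q a b c (2 * n) = (transfer q a b c n).total ∧
    topSum q a b c (oddWeightA a c) (2 * n) = (transfer q a b c n).oddA ∧
    topSum q a b c (oddWeightB a b c) (2 * n) = (transfer q a b c n).oddB ∧
    topSum q a b c (chainWeight a b c) (2 * n + 1) =
      (c + a * b) * q ^ (2 * n + 2) * (transfer q a b c n).even := by
  induction n with
  | zero =>
    simp [topSum, gapGF_zero, transfer, oddWeightA, oddWeightB, startFactor, chainWeight]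
  | succ n ih =>
    obtain ⟨hs, hA, hB, hd⟩ := ih
    have hodd := gapGF_odd_succ q a b c n
    rw [hs, hA, hB] at hodd
    refine ⟨?_, ?_, ?_, ?_⟩
    · rw [show 2 * (n + 1) = 2 * n + 1 + 1 by ring, gapGF_succ, hodd, hd]
      rfl
    · rw [show 2 * (n + 1) = 2 * n + 2 by ring, topSum_add_two]
      simp only [oddWeightA_succ, topSum_const_mul, hs, hA, transfer]
      simp only [oddWeightA, startFactor]
      rw [if_neg (by omega)]
      ring
    · rw [show 2 * (n + 1) = 2 * n + 2 by ring, topSum_add_two,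
        topSum_congr q a b c (G := fun lam len => (1 + c) * b * oddWeightA a c lam len +
          b * oddWeightB a b c lam len) fun j _ => oddWeightB_succ a b c _ (Nat.succ_pos j),
        topSum_add, topSum_const_mul, topSum_const_mul, hs, hA, hB]
      simp only [oddWeightB, startFactor, transfer]
      rw [if_neg (by omega)]
      simp
      ring
    · rw [show 2 * (n + 1) + 1 = 2 * n + 3 by ring, topSum_even_add_two, hodd, hd]
      simp only [transfer]
      ring

theorem gapGF_odd (q a b c : R) (n : ℕ) :
    gapGF q a b c (2 * n + 1) = oddTotal q a b c n := by
  obtain ⟨hs, hA, hB, -⟩ := gapGF_eq_transfer q a b c n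
  rw [gapGF_odd_succ, hs, hA, hB, oddTotal]

theorem map_setWeight {S : Type*} [CommRing S] (f : R →+* S) (a b c : R) (T : Finset ℕ) :
    f (setWeight a b c T) = setWeight (f a) (f b) (f c) T := by
  have h (lam len : ℕ) :
      f (chainWeight a b c lam len) = chainWeight (f a) (f b) (f c) lam len := by
    simp only [chainWeight, oddBlockWeight]
    split_ifs <;> simp
  simp [setWeight, h]

theorem map_gapGF {S : Type*} [CommRing S] (f : R →+* S) (q a b c : R) (N : ℕ) :
    f (gapGF q a b c N) = gapGF (f q) (f a) (f b) (f c) N := by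
  simp [gapGF, map_setWeight]

open Polynomial in
/-- The generating function agrees with the product in all degrees up to `2 * n + 1`. -/
theorem coeff_gapGF (a b c : R) {m n : ℕ} (hmn : m < 2 * n + 2) :
    (gapGF (X : R[X]) (C a) (C b) (C c) (2 * n + 1)).coeff m =
      ((∏ k ∈ Finset.range (n + 1), (1 + C a * X ^ (2 * k + 1))) *
      (∏ k ∈ Finset.range (n + 1), (1 + C b * X ^ (2 * k + 1))) *
      ∏ k ∈ Finset.range (n + 1), (1 + C c * X ^ (2 * k + 2))).coeff m := by
  -- In this quotient q = X is nilpotent, as `oddTotal_eq_prod` requires.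
  let f := Ideal.Quotient.mk (Ideal.span {(X : R[X]) ^ (2 * n + 2)})
  have hX : f X ^ (2 * n + 2) = 0 := by
    rw [← map_pow]
    exact Ideal.Quotient.eq_zero_iff_mem.2 (Ideal.mem_span_singleton_self _)
  have h := oddTotal_eq_prod hX (f (C a)) (f (C b)) (f (C c))
  rw [← gapGF_odd, ← map_gapGF] at h
  have h' : f (gapGF (X : R[X]) (C a) (C b) (C c) (2 * n + 1)) =
      f ((∏ k ∈ Finset.range (n + 1), (1 + C a * X ^ (2 * k + 1))) *
      (∏ k ∈ Finset.range (n + 1), (1 + C b * X ^ (2 * k + 1))) *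
      ∏ k ∈ Finset.range (n + 1), (1 + C c * X ^ (2 * k + 2))) := by
    rw [h]
    simp
  rw [Ideal.Quotient.eq, Ideal.mem_span_singleton, X_pow_dvd_iff] at h'
  have := h' m hmn
  rwa [coeff_sub, sub_eq_zero] at this

end GeneratingFunction

/-! ### From coefficients back to partitions -/

section Partitions

variable {R : Type*} [CommRing R]

/-- Partitions into distinct parts are the same as finite sets of positive integers. -/
theorem sum_partition_eq_sum_finset {n : ℕ} {s : Finset n.Partition} {t : Finset (Finset ℕ)}
    (hs : ∀ p ∈ s, p.parts.Nodup ∧ p.parts.toFinset ∈ t)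
    (ht : ∀ S ∈ t, 0 ∉ S ∧ ∑ m ∈ S, m = n ∧ ∀ p : n.Partition, p.parts = S.val → p ∈ s)
    (F : Finset ℕ → R) : ∑ p ∈ s, F p.parts.toFinset = ∑ S ∈ t, F S := by
  refine Finset.sum_bij (fun p _ => p.parts.toFinset) (fun p hp => (hs p hp).2) ?_ ?_
    fun _ _ => rfl
  · intro p hp p' hp' h
    apply Nat.Partition.ext
    rw [← (hs p hp).1.dedup, ← (hs p' hp').1.dedup, ← Multiset.toFinset_val,
      ← Multiset.toFinset_val, h]
  · intro S hS
    obtain ⟨h0, hsum, hp⟩ := ht S hS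
    refine ⟨⟨S.val, fun {i} hi => Nat.pos_of_ne_zero fun h => h0 (h ▸ hi), ?_⟩, hp _ rfl, ?_⟩
    · rw [← hsum, Finset.sum, Multiset.map_id']
    · simp

open Polynomial in
theorem coeff_sum_X_pow (t : Finset (Finset ℕ)) (w : Finset ℕ → R) (n : ℕ) :
    (∑ S ∈ t, C (w S) * X ^ ∑ m ∈ S, m).coeff n =
      ∑ S ∈ t.filter (fun S => ∑ m ∈ S, m = n), w S := by
  simp only [finsetSum_coeff, coeff_C_mul_X_pow, Finset.sum_filter, eq_comm]

open Polynomial in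
theorem sum_restricted_distincts (a : R) (P : ℕ → Prop) [DecidablePred P] {T : Finset ℕ} {n : ℕ}
    (hT0 : 0 ∉ T) (hT : ∀ i ∈ T, P i) (hT' : ∀ i, 1 ≤ i → i ≤ n → P i → i ∈ T) :
    ∑ p ∈ Nat.Partition.restricted n P ∩ Nat.Partition.distincts n, a ^ p.parts.card =
      (∏ i ∈ T, (1 + C a * X ^ i)).coeff n := by
  have h : ∏ i ∈ T, (1 + C a * X ^ i) = ∑ S ∈ T.powerset, C (a ^ S.card) * X ^ ∑ m ∈ S, m := by
    rw [Finset.prod_one_add]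
    refine Finset.sum_congr rfl fun S _ => ?_
    rw [Finset.prod_mul_distrib, Finset.prod_const, Finset.prod_pow_eq_pow_sum, C_pow]
  rw [h, coeff_sum_X_pow, ← sum_partition_eq_sum_finset
    (s := Nat.Partition.restricted n P ∩ Nat.Partition.distincts n)]
  · refine Finset.sum_congr rfl fun p hp => ?_
    simp only [Finset.mem_inter, Nat.Partition.distincts, Finset.mem_filter] at hp
    rw [Multiset.toFinset_card_of_nodup hp.2.2]
  · intro p hp
    simp only [Finset.mem_inter, Nat.Partition.distincts, Nat.Partition.restricted,
      Finset.mem_filter, Finset.mem_univ, true_and] at hp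
    refine ⟨hp.2, Finset.mem_filter.2 ⟨Finset.mem_powerset.2 fun i hi => ?_, ?_⟩⟩
    · rw [Multiset.mem_toFinset] at hi
      exact hT' i (p.parts_pos hi) (Nat.Partition.le_of_mem_parts hi) (hp.1 i hi)
    · rw [Finset.sum, Multiset.toFinset_val, hp.2.dedup, Multiset.map_id', p.parts_sum]
  · intro S hS
    rw [Finset.mem_filter, Finset.mem_powerset] at hS
    refine ⟨fun h => hT0 (hS.1 h), hS.2, fun p hp => ?_⟩
    simp only [Finset.mem_inter, Nat.Partition.distincts, Nat.Partition.restricted,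
      Finset.mem_filter, Finset.mem_univ, true_and, hp]
    exact ⟨fun i hi => hT i (hS.1 hi), S.nodup⟩

open Polynomial in
theorem sum_oddDistincts (a : R) {m n : ℕ} (hmn : m ≤ n) :
    ∑ p ∈ Nat.Partition.oddDistincts m, a ^ p.parts.card =
      (∏ k ∈ Finset.range (n + 1), (1 + C a * X ^ (2 * k + 1))).coeff m := by
  have h := sum_restricted_distincts a (fun i => ¬ Even i) (n := m)
    (T := (Finset.range (n + 1)).image fun k => 2 * k + 1) (by simp) (by simp) ?_
  · rw [Finset.prod_image fun _ _ _ _ h => by omega] at h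
    exact h
  · intro i _ hi hodd
    obtain ⟨k, rfl⟩ := Nat.not_even_iff_odd.1 hodd
    exact Finset.mem_image.2 ⟨k, by simp; omega, rfl⟩

open Polynomial in
theorem sum_evenDistincts (c : R) {m n : ℕ} (hmn : m ≤ n) :
    ∑ p ∈ evenDistincts m, c ^ p.parts.card =
      (∏ k ∈ Finset.range (n + 1), (1 + C c * X ^ (2 * k + 2))).coeff m := by
  have h := sum_restricted_distincts c Even (n := m)
    (T := (Finset.range (n + 1)).image fun k => 2 * k + 2) (by simp) (by simp [parity_simps]) ?_
  · rw [Finset.prod_image fun _ _ _ _ h => by omega] at h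
    exact h
  · intro i hi1 hi heven
    obtain ⟨k, rfl⟩ := heven
    exact Finset.mem_image.2 ⟨k - 1, by simp; omega, by omega⟩

-- Any bound at least n on the parts would do; 2n + 1 is the one matching `coeff_gapGF`.
open Polynomial in
theorem sum_rrPartitions (a b c : R) (n : ℕ) :
    ∑ p ∈ rrPartitions n, weight a b c p =
      (gapGF (X : R[X]) (C a) (C b) (C c) (2 * n + 1)).coeff n := by
  simp only [gapGF, ← map_setWeight]
  rw [coeff_sum_X_pow, ← sum_partition_eq_sum_finset (s := rrPartitions n)]
  · rfl
  · intro p hp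
    simp only [rrPartitions, Finset.mem_filter, Finset.mem_univ, true_and] at hp
    refine ⟨hp.1, Finset.mem_filter.2 ⟨mem_gapSets.2 ⟨fun m hm => ?_, ?_⟩, ?_⟩⟩
    · rw [Multiset.mem_toFinset] at hm
      have := p.parts_pos hm
      have := Nat.Partition.le_of_mem_parts hm
      omega
    · simpa using hp.2
    · rw [Finset.sum, Multiset.toFinset_val, hp.1.dedup, Multiset.map_id', p.parts_sum]
  · intro S hS
    rw [Finset.mem_filter, mem_gapSets] at hS
    refine ⟨fun h => by have := hS.1.1 0 h; omega, hS.2, fun p hp => ?_⟩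
    simp only [rrPartitions, Finset.mem_filter, Finset.mem_univ, true_and, hp]
    exact ⟨S.nodup, hS.1.2⟩

open Polynomial in
theorem coeff_mul_mul (f g h : R[X]) (n : ℕ) :
    (f * g * h).coeff n =
      ∑ s ∈ (Finset.range (n + 1) ×ˢ Finset.range (n + 1) ×ˢ Finset.range (n + 1)).filter
        (fun s => s.1 + s.2.1 + s.2.2 = n), f.coeff s.1 * g.coeff s.2.1 * h.coeff s.2.2 := by
  simp only [coeff_mul, Finset.sum_mul]
  rw [Finset.sum_sigma']
  refine Finset.sum_bij' (fun x _ => (x.2.1, x.2.2, x.1.2))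
    (fun s _ => ⟨(s.1 + s.2.1, s.2.2), (s.1, s.2.1)⟩) ?_ ?_ ?_ ?_ ?_
  · rintro ⟨⟨i, j⟩, k, l⟩ h
    have h1 : i + j = n := Finset.HasAntidiagonal.mem_antidiagonal.1 (Finset.mem_sigma.1 h).1
    have h2 : k + l = i := Finset.HasAntidiagonal.mem_antidiagonal.1 (Finset.mem_sigma.1 h).2
    simp only [Finset.mem_filter, Finset.mem_product, Finset.mem_range]
    omega
  · rintro ⟨i, j, k⟩ h
    simp only [Finset.mem_filter] at h
    simpa using h.2
  · rintro ⟨⟨i, j⟩, k, l⟩ h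
    obtain rfl : k + l = i := Finset.HasAntidiagonal.mem_antidiagonal.1 (Finset.mem_sigma.1 h).2
    rfl
  · rintro ⟨i, j, k⟩ _
    rfl
  · rintro ⟨⟨i, j⟩, k, l⟩ _
    rfl

open Polynomial in
theorem sum_vectorPartitions (a b c : R) (n : ℕ) :
    ∑ v ∈ vectorPartitions n,
        a ^ v.2.1.parts.card * b ^ v.2.2.1.parts.card * c ^ v.2.2.2.parts.card =
      ((∏ k ∈ Finset.range (n + 1), (1 + C a * X ^ (2 * k + 1))) *
      (∏ k ∈ Finset.range (n + 1), (1 + C b * X ^ (2 * k + 1))) *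
      ∏ k ∈ Finset.range (n + 1), (1 + C c * X ^ (2 * k + 2))).coeff n := by
  rw [coeff_mul_mul, vectorPartitions, Finset.sum_sigma]
  refine Finset.sum_congr rfl fun s hs => ?_
  rw [Finset.mem_filter] at hs
  rw [← sum_oddDistincts a (show s.1 ≤ n by omega), ← sum_oddDistincts b (show s.2.1 ≤ n by omega),
    ← sum_evenDistincts c (show s.2.2 ≤ n by omega), Finset.sum_product, mul_assoc,
    Finset.sum_mul]
  refine Finset.sum_congr rfl fun p _ => ?_
  rw [Finset.sum_product, Finset.sum_mul_sum, Finset.mul_sum]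
  refine Finset.sum_congr rfl fun p' _ => ?_
  simp only [Finset.mul_sum, mul_assoc]

end Partitions

end RogersRamanujan

theorem theorem1 {K : Type*} [CommRing K] (a b c : K) (n : ℕ) :
    ∑ p ∈ RogersRamanujan.rrPartitions n, RogersRamanujan.weight a b c p =
      ∑ v ∈ RogersRamanujan.vectorPartitions n,
        a ^ v.2.1.parts.card * b ^ v.2.2.1.parts.card * c ^ v.2.2.2.parts.card := by
  rw [RogersRamanujan.sum_rrPartitions, RogersRamanujan.coeff_gapGF a b c (by omega),
    RogersRamanujan.sum_vectorPartitions]
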